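/- Let $\Omega$ be a non-empty set, $\mathfrak F(\Omega)=\mathbb R^\Omega$, and $\mathfrak B(\Omega)$ the bounded functions in $\mathfrak F(\Omega)$. Let $\ge_*$ be a reflexive, transitive relation on $\mathfrak F(\Omega)$ with asymmetric part $>_*$ such that: $1>_*0$; $f\ge g$ pointwise implies $f\ge_*g$; $f\ge_*g$ implies $bf+h\ge_*bg+h$ for all $b\in\mathfrak B(\Omega)_+$ and $h\in\mathfrak F(\Omega)$; and $f>_*0$ implies $f\wedge1>_*0$. A set $A\subset\Omega$ is negligible if $0\ge_*\mathbf 1_A$. Let $\mathcal X\subset\mathfrak F(\Omega)$ be a convex set that contains $0$ and $1$, such that every $f\in\mathcal X$ satisfies $f\ge_*a$ for some $a\in\mathbb R$, and $f+\lambda\in\mathcal X$ for all $f\in\mathcal X$, $\lambda\ge0$. Put $$L(\mathcal X)=\{g\in\mathfrak F(\Omega):\lambda X\ge_*|g|\text{ for some }\lambda>0,\ X\in\mathcal X\}.$$ For $D\subset\mathfrak F(\Omega)$ let $\Pi_0(D)$ be the set of functionals $\pi:D\to\mathbb R$ that are positively homogeneous and subadditive (whenever the functions involved lie in $D$), satisfy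 $\pi(1)=1$, and are monotone: $X\ge_*Y$ implies $\pi(X)\ge\pi(Y)$. Let $\Pi(D)$ be the set of those $\pi\in\Pi_0(D)$ with $\pi(X)>0$ whenever $X\in D$ and $X>_*0$. For $\pi\in\Pi_0(\mathcal X)$ let $\mathrm{Ext}_0(\pi)$ (respectively $\mathrm{Ext}(\pi)$) be the set of $\rho\in\Pi_0(L(\mathcal X))$ (respectively $\rho\in\Pi(L(\mathcal X))$) with $\rho\le\pi$ on $\mathcal X$. A functional $\rho$ on $L(\mathcal X)$ is cash additive if $\rho(f+a)=\rho(f)+a$ for all $f\in L(\mathcal X)$ and $a\in\mathbb R$ with $f+a\in L(\mathcal X)$. Let $M_0(\pi)$ be the set of finitely additive probabilities $m$ on the power set of $\Omega$ which vanish on negligible sets, satisfy $L(\mathcal X)\subset L^1(m)$ (finitely additive integration in the sense of Dunford and Schwartz), and $\int X\,dm\le\pi(X)$ for every $X\in\mathcal X$. Let $M(\pi)$ be the set of those $m\in M_0(\pi)$ with $\int(f\wedge1)\,dm>0$ for every $f>_*0$. Let $\mathcal S$ be the set of sequences $(f_n)_{n\ge1}$ in $\mathfrak B(\Omega)_+$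 whose pointwise sum is a bounded function. For $\rho\in\Pi_0(L(\mathcal X))$ and $(f_n)\in\mathcal S$ define, in the extended reals (with $0/0=0$ and $-c/0=-\infty$ for $c>0$), $$ma_c(\rho;f_1,f_2,\ldots)=\lim_{k\to\infty}\frac{\sum_{n\le k}\rho(f_n)-\rho\big(\sum_nf_n\big)}{\sum_{n\le k}\rho(f_n)},\qquad ma_c(\rho)=\sup_{\mathcal S}ma_c(\rho;f_1,f_2,\ldots),\qquad na_c(\rho)=-\inf_{\mathcal S}ma_c(\rho;f_1,f_2,\ldots).$$ **Theorem.** Let $\pi\in\Pi_0(\mathcal X)$. (a) $M_0(\pi)$ contains a countably additive element if and only if there exists $\rho\in\mathrm{Ext}_0(\pi)$ such that $na_c(\rho)<+\infty$ and $\sum_n\rho(f_n)<\infty$ for every $(f_n)\in\mathcal S$. (b) $M(\pi)$ contains a countably additive element if and only if there exists a cash additive $\rho\in\mathrm{Ext}(\pi)$ such that $na_c(\rho)<+\infty$ and $ma_c(\rho)<1$. -/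

import Mathlib

open Filter Topology

/-- A common order `≥_*` on all real functions on `Ω` : `O.ge f g` reads `f ≥_* g`. -/
structure CommonOrder (Ω : Type*) where
  ge : (Ω → ℝ) → (Ω → ℝ) → Prop
  refl : ∀ f, ge f f
  trans : ∀ f g h, ge f g → ge g h → ge f h
  /-- together with `mono` this is `1 >_* 0` -/
  not_zero_ge_one : ¬ ge 0 1
  mono : ∀ f g : Ω → ℝ, g ≤ f → ge f g
  affine : ∀ f g b h : Ω → ℝ, 0 ≤ b → (∃ C : ℝ, ∀ ω, b ω ≤ C) →
    ge f g → ge (b * f + h) (b * g + h)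
  trunc : ∀ f : Ω → ℝ, ge f 0 → ¬ ge 0 f → ge (f ⊓ 1) 0 ∧ ¬ ge 0 (f ⊓ 1)

namespace CommonOrder

variable {Ω : Type*} (O : CommonOrder Ω)

/-- The asymmetric part `f >_* g`. -/
def gt (f g : Ω → ℝ) : Prop := O.ge f g ∧ ¬ O.ge g f

/-- The negligible sets: `0 ≥_* 1_A`. -/
def Negligible (A : Set Ω) : Prop := O.ge 0 (A.indicator 1)

/-- Conditions on a set of traded payoffs. -/
structure IsMarket (X : Set (Ω → ℝ)) : Prop where
  convex : Convex ℝ X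
  zero_mem : (0 : Ω → ℝ) ∈ X
  one_mem : (1 : Ω → ℝ) ∈ X
  bddBelow : ∀ f ∈ X, ∃ a : ℝ, O.ge f (fun _ => a)
  add_const_mem : ∀ f ∈ X, ∀ c : ℝ, 0 ≤ c → (fun ω => f ω + c) ∈ X

/-- The complete market `L(X)`: all `g` with `c • f ≥_* |g|` for some `c > 0` and `f ∈ X`. -/
def L (X : Set (Ω → ℝ)) : Set (Ω → ℝ) :=
  {g | ∃ c : ℝ, 0 < c ∧ ∃ f ∈ X, O.ge (c • f) |g|}

/-- The pricing functionals `Π₀(D)` on a set `D` of payoffs.  A functional on `D` is represented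
by a function on all of `Ω → ℝ`, of which only the values on `D` are ever used. -/
structure IsPricing (D : Set (Ω → ℝ)) (π : (Ω → ℝ) → ℝ) : Prop where
  posHom : ∀ f ∈ D, ∀ c : ℝ, 0 < c → c • f ∈ D → π (c • f) = c * π f
  subadd : ∀ f ∈ D, ∀ g ∈ D, f + g ∈ D → π (f + g) ≤ π f + π g
  map_one : π 1 = 1
  mono : ∀ f ∈ D, ∀ g ∈ D, O.ge f g → π g ≤ π f

/-- The price functions `Π(D)`: pricing functionals free of arbitrage. -/
structure IsPrice (D : Set (Ω → ℝ)) (π : (Ω → ℝ) → ℝ) : Prop extends O.IsPricing D π where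
  noArbitrage : ∀ f ∈ D, O.gt f 0 → 0 < π f

/-- `Ext₀(π)`: pricing functionals on `L(X)` dominated by `π` on `X`. -/
def Ext₀ (X : Set (Ω → ℝ)) (π : (Ω → ℝ) → ℝ) : Set ((Ω → ℝ) → ℝ) :=
  {ρ | O.IsPricing (O.L X) ρ ∧ ∀ f ∈ X, ρ f ≤ π f}

/-- `Ext(π)`: price functions on `L(X)` dominated by `π` on `X`. -/
def Ext (X : Set (Ω → ℝ)) (π : (Ω → ℝ) → ℝ) : Set ((Ω → ℝ) → ℝ) :=
  {ρ | O.IsPrice (O.L X) ρ ∧ ∀ f ∈ X, ρ f ≤ π f}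

end CommonOrder

/-- Cash additivity of a functional on `D`. -/
def CashAdditive {Ω : Type*} (D : Set (Ω → ℝ)) (π : (Ω → ℝ) → ℝ) : Prop :=
  ∀ f ∈ D, ∀ a : ℝ, (fun ω => f ω + a) ∈ D → π (fun ω => f ω + a) = π f + a

/-- Finitely additive probabilities on the power set of `Ω`. -/
structure FinAddProb (Ω : Type*) where
  toFun : Set Ω → ℝ
  nonneg : ∀ A, 0 ≤ toFun A
  map_univ : toFun Set.univ = 1
  map_union : ∀ A B, Disjoint A B → toFun (A ∪ B) = toFun A + toFun B

namespace FinAddProb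

variable {Ω : Type*} (m : FinAddProb Ω)

def CountablyAdditive : Prop :=
  ∀ A : ℕ → Set Ω, Pairwise (Function.onFun Disjoint A) →
    HasSum (fun n => m.toFun (A n)) (m.toFun (⋃ n, A n))

/-- The integral of a function with finite range. -/
noncomputable def simpleIntegral (s : Ω → ℝ) : ℝ := ∑ᶠ y : ℝ, y * m.toFun (s ⁻¹' {y})

/-- A determining sequence for `f` (Dunford–Schwartz): simple functions which converge to `f` in
`m`-measure and are Cauchy in mean. -/
structure Determines (s : ℕ → Ω → ℝ) (f : Ω → ℝ) : Prop where
  simple : ∀ n, (Set.range (s n)).Finite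
  inMeasure : ∀ ε : ℝ, 0 < ε →
    Tendsto (fun n => m.toFun {ω | ε < |s n ω - f ω|}) atTop (𝓝 0)
  cauchy : Tendsto (fun p : ℕ × ℕ => m.simpleIntegral (fun ω => |s p.1 ω - s p.2 ω|))
    atTop (𝓝 0)

/-- Membership in `L¹(m)`. -/
def Integrable (f : Ω → ℝ) : Prop := ∃ s, m.Determines s f

/-- `I` is the integral of `f`: the limit of the integrals along a determining sequence. -/
def HasIntegral (f : Ω → ℝ) (I : ℝ) : Prop :=
  ∃ s, m.Determines s f ∧ Tendsto (fun n => m.simpleIntegral (s n)) atTop (𝓝 I)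

open Classical in
/-- The integral `∫ f dm`, with the value `0` when `f` is not integrable. -/
noncomputable def integral (f : Ω → ℝ) : ℝ :=
  if h : ∃ I, m.HasIntegral f I then h.choose else 0

end FinAddProb

namespace CommonOrder

variable {Ω : Type*} (O : CommonOrder Ω)

/-- The pricing measures: finitely additive probabilities vanishing on negligible sets, for which
all of `L(X)` is integrable and whose integral is dominated by `π` on `X`. -/
structure IsPricingMeasure (X : Set (Ω → ℝ)) (π : (Ω → ℝ) → ℝ) (m : FinAddProb Ω) : Prop where
  negligible : ∀ A, O.Negligible A → m.toFun A = 0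
  integrable : ∀ f ∈ O.L X, m.Integrable f
  le : ∀ f ∈ X, m.integral f ≤ π f

/-- The set `M₀(π)`. -/
def M₀ (X : Set (Ω → ℝ)) (π : (Ω → ℝ) → ℝ) : Set (FinAddProb Ω) :=
  {m | O.IsPricingMeasure X π m}

/-- The set `M(π)` of strictly positive pricing measures. -/
def M (X : Set (Ω → ℝ)) (π : (Ω → ℝ) → ℝ) : Set (FinAddProb Ω) :=
  {m | m ∈ O.M₀ X π ∧ ∀ f : Ω → ℝ, O.gt f 0 → 0 < m.integral (f ⊓ 1)}

end CommonOrder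

section MarketPower

variable {Ω : Type*}

/-- Sequences of nonnegative bounded functions whose pointwise sum exists and is bounded. -/
structure BoundedSumSeq (f : ℕ → Ω → ℝ) : Prop where
  nonneg : ∀ n, 0 ≤ f n
  bounded : ∀ n, ∃ C : ℝ, ∀ ω, f n ω ≤ C
  summable : ∀ ω, Summable fun n => f n ω
  sum_bounded : ∃ C : ℝ, ∀ ω, ∑' n, f n ω ≤ C

/-- The quotient `x / y` in the extended reals, for `y ≥ 0`, with `0 / 0 = 0` and
`x / 0 = ± ∞` for `x ≠ 0`. -/
noncomputable def extDiv (x y : ℝ) : EReal :=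
  if y = 0 then (if x = 0 then 0 else if 0 < x then ⊤ else ⊥) else ((x / y : ℝ) : EReal)

/-- The quotient whose limit in `k` is `ma_c(ρ; f₁, f₂, …)`. -/
noncomputable def macPartial (ρ : (Ω → ℝ) → ℝ) (f : ℕ → Ω → ℝ) (k : ℕ) : EReal :=
  extDiv ((∑ n ∈ Finset.range k, ρ (f n)) - ρ (fun ω => ∑' n, f n ω))
    (∑ n ∈ Finset.range k, ρ (f n))

/-- `ma_c(ρ; f₁, f₂, …)`. -/
noncomputable def macSeq (ρ : (Ω → ℝ) → ℝ) (f : ℕ → Ω → ℝ) : EReal :=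
  limUnder atTop (macPartial ρ f)

/-- The limit that defines `ma_c(ρ; f₁, f₂, …)` exists. -/
theorem tendsto_macSeq (ρ : (Ω → ℝ) → ℝ) (f : ℕ → Ω → ℝ) (h : ∀ n, 0 ≤ ρ (f n))
    (hs : 0 ≤ ρ (fun ω => ∑' n, f n ω)) :
    Tendsto (macPartial ρ f) atTop (𝓝 (macSeq ρ f)) := by
  have key : Monotone (macPartial ρ f) := by
    intro j k hjk
    have h1 : ∑ n ∈ Finset.range j, ρ (f n) ≤ ∑ n ∈ Finset.range k, ρ (f n) :=
      Finset.sum_le_sum_of_subset_of_nonneg (Finset.range_mono hjk) fun n _ _ => h n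
    have h0 : 0 ≤ ∑ n ∈ Finset.range j, ρ (f n) := Finset.sum_nonneg fun n _ => h n
    unfold macPartial
    generalize ∑ n ∈ Finset.range j, ρ (f n) = a at *
    generalize ∑ n ∈ Finset.range k, ρ (f n) = b at *
    generalize ρ (fun ω => ∑' n, f n ω) = r at *
    unfold extDiv
    rcases h0.eq_or_lt with ha | ha
    · subst ha
      rcases hs.eq_or_lt with hr | hr
      · subst hr
        by_cases hb : b = 0
        · simp [hb]
        · simp [hb]
      · have h2 : ¬ (0 : ℝ) < 0 - r := by linarith
        have h3 : (0 : ℝ) - r ≠ 0 := by linarith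
        simp only [if_true, if_neg h2, if_neg h3]
        exact bot_le
    · have hb : 0 < b := lt_of_lt_of_le ha h1
      rw [if_neg ha.ne', if_neg hb.ne', EReal.coe_le_coe_iff, sub_div, sub_div,
        div_self ha.ne', div_self hb.ne']
      have : r / b ≤ r / a := by gcongr
      linarith
  exact tendsto_nhds_limUnder ⟨_, tendsto_atTop_iSup key⟩

/-- `ma_c(ρ)`, an extended real. -/
noncomputable def mac (ρ : (Ω → ℝ) → ℝ) : EReal :=
  ⨆ (f : ℕ → Ω → ℝ) (_ : BoundedSumSeq f), macSeq ρ f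

/-- `na_c(ρ)`, an extended real. -/
noncomputable def nac (ρ : (Ω → ℝ) → ℝ) : EReal :=
  -⨅ (f : ℕ → Ω → ℝ) (_ : BoundedSumSeq f), macSeq ρ f

end MarketPower

/-! A countably additive pricing measure gives a price by integration. This `ρ` is linear, and
dominated convergence makes every quotient `macSeq ρ f` equal to `0`, so all the conditions on `ρ`
hold.

Conversely, Hahn–Banach gives a linear `ψ ≤ ρ` on `L(X)` with `ψ 1 = 1`. Finiteness of `nac ρ` means
`ρ (∑ fₙ) ≤ K ∑ ρ (fₙ)`; applied to the tails of a disjoint sequence of sets, with `∑ ρ (fₙ) < ∞`,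
it forces `A ↦ ψ (1_A)` to be countably additive (`hasSum_linear_indicator`). Approximation by
simple functions from below gives `∫ g ≤ ψ g` for `g ≥_* 0` in `L(X)`, hence integrability and,
after a shift by a lower bound, `∫ f ≤ π f` on `X` (`exists_pricingMeasure`).

For strict positivity, `mac ρ < 1` means `δ ∑ ρ (fₙ) ≤ ρ (∑ fₙ)` with `δ > 0`. This near
superadditivity is what a sandwich form of Hahn–Banach needs to give also `δ ρ ≤ ψ` on bounded
nonnegative functions (`exists_linear_ge_on`), so `ψ` inherits the absence of arbitrage from `ρ`. -/

section

open MeasureTheory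

/-! ### The Dunford–Schwartz integral for a countably additive probability is the Lebesgue integral.
-/

namespace FinAddProb

variable {Ω : Type*}

/-- The measure on the discrete σ-algebra given by a countably additive probability. -/
noncomputable def toMeasure (m : FinAddProb Ω) (hm : m.CountablyAdditive) : @Measure Ω ⊤ :=
  @Measure.ofMeasurable Ω ⊤ (fun A _ => ENNReal.ofReal (m.toFun A))
    (by
      have h := m.map_union ∅ ∅ (by simp)
      simp only [Set.union_self] at h
      simp [show m.toFun ∅ = 0 by linarith])
    (by
      intro A _ hd
      have h := hm A hd
      rw [← h.tsum_eq, ENNReal.ofReal_tsum_of_nonneg (fun n => m.nonneg _) h.summable])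

theorem toMeasure_apply (m : FinAddProb Ω) (hm : m.CountablyAdditive) (A : Set Ω) :
    m.toMeasure hm A = ENNReal.ofReal (m.toFun A) :=
  @Measure.ofMeasurable_apply Ω ⊤ _ _ _ A trivial

theorem exists_measure (m : FinAddProb Ω) (hm : m.CountablyAdditive) :
    ∃ μ : @Measure Ω ⊤, IsProbabilityMeasure μ ∧ ∀ A, m.toFun A = μ.real A := by
  refine ⟨m.toMeasure hm, ⟨?_⟩, fun A => ?_⟩
  · rw [toMeasure_apply, m.map_univ, ENNReal.ofReal_one]
  · rw [Measure.real, toMeasure_apply, ENNReal.toReal_ofReal (m.nonneg A)]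

theorem finite_range_abs_sub {s t : Ω → ℝ} (hs : (Set.range s).Finite)
    (ht : (Set.range t).Finite) : (Set.range fun ω => |s ω - t ω|).Finite :=
  (hs.image2 (fun x y => |x - y|) ht).subset (by
    rintro _ ⟨ω, rfl⟩
    exact ⟨s ω, ⟨ω, rfl⟩, t ω, ⟨ω, rfl⟩, rfl⟩)

theorem dist_toL1 [MeasurableSpace Ω] {μ : Measure Ω} {f g : Ω → ℝ} (hf : MeasureTheory.Integrable f μ)
    (hg : MeasureTheory.Integrable g μ) :
    dist (hf.toL1 f) (hg.toL1 g) = ∫ ω, |f ω - g ω| ∂μ := by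
  rw [dist_eq_norm, ← Integrable.toL1_sub, L1.norm_of_fun_eq_integral_norm]
  rfl

variable [MeasurableSpace Ω] [DiscreteMeasurableSpace Ω] {m : FinAddProb Ω} {μ : Measure Ω}
  [IsProbabilityMeasure μ]

theorem integrable_of_finite_range {s : Ω → ℝ} (hs : (Set.range s).Finite) :
    MeasureTheory.Integrable s μ := by
  obtain ⟨C, hC⟩ := (hs.image fun x => ‖x‖).bddAbove
  refine Integrable.of_bound Measurable.of_discrete.aestronglyMeasurable C (ae_of_all _ fun ω => ?_)
  exact hC ⟨s ω, ⟨ω, rfl⟩, rfl⟩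

theorem simpleIntegral_eq (hm : ∀ A, m.toFun A = μ.real A) {s : Ω → ℝ}
    (hs : (Set.range s).Finite) : m.simpleIntegral s = ∫ ω, s ω ∂μ := by
  let S : SimpleFunc Ω ℝ := ⟨s, fun _ => .of_discrete, hs⟩
  have h := SimpleFunc.integral_eq_sum S (integrable_of_finite_range (μ := μ) hs)
  change ∫ ω, s ω ∂μ = _ at h
  rw [h, simpleIntegral, finsum_eq_sum_of_support_subset (s := S.range)]
  · exact Finset.sum_congr rfl fun y _ => by rw [hm, smul_eq_mul, mul_comm]; rfl
  · intro y hy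
    by_contra hy'
    apply hy
    have : s ⁻¹' {y} = ∅ := by
      ext ω
      simp only [Set.mem_preimage, Set.mem_singleton_iff, Set.mem_empty_iff_false, iff_false]
      rintro rfl
      exact hy' (by simp [S])
    simp [this, hm]

/-- Cauchy in mean is Cauchy in `L¹(μ)`, which is complete; the `L¹` limit is `f` almost everywhere
because limits in measure are unique. -/
theorem Determines.integrable_and_tendsto (hm : ∀ A, m.toFun A = μ.real A) {s : ℕ → Ω → ℝ}
    {f : Ω → ℝ} (h : m.Determines s f) : MeasureTheory.Integrable f μ ∧
      Tendsto (fun n => m.simpleIntegral (s n)) atTop (𝓝 (∫ ω, f ω ∂μ)) := by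
  have hi := fun n => integrable_of_finite_range (μ := μ) (h.simple n)
  have hc : CauchySeq fun n => (hi n).toL1 (s n) := by
    rw [cauchySeq_iff_tendsto_dist_atTop_0]
    refine h.cauchy.congr fun p => ?_
    rw [dist_toL1, simpleIntegral_eq hm (finite_range_abs_sub (h.simple _) (h.simple _))]
  obtain ⟨g, hg⟩ := cauchySeq_tendsto_of_complete hc
  have hg1 : TendstoInMeasure μ s atTop g :=
    (tendstoInMeasure_of_tendsto_Lp hg).congr (fun n => (hi n).coeFn_toL1) (ae_eq_refl _)
  have hf1 : TendstoInMeasure μ s atTop f := by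
    rw [tendstoInMeasure_iff_measureReal_norm]
    intro ε hε
    -- `ε / 2` passes from the non-strict inequality of `TendstoInMeasure` to the strict one of
    -- `Determines`.
    refine squeeze_zero (fun n => measureReal_nonneg) (fun n => ?_) (h.inMeasure (ε / 2) (by positivity))
    rw [hm]
    exact measureReal_mono fun ω (hω : ε ≤ ‖s n ω - f ω‖) =>
      lt_of_lt_of_le (half_lt_self hε) hω
  have hgf := tendstoInMeasure_ae_unique hg1 hf1
  refine ⟨(L1.integrable_coeFn g).congr hgf, ?_⟩
  rw [← integral_congr_ae hgf, ← L1.integral_eq_integral]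
  refine ((L1.continuous_integral.tendsto g).comp hg).congr fun n => ?_
  rw [Function.comp, ← integral_eq, simpleIntegral_eq hm (h.simple n)]

theorem exists_determines (hm : ∀ A, m.toFun A = μ.real A) {f : Ω → ℝ}
    (hf : MeasureTheory.Integrable f μ) : ∃ s, m.Determines s f := by
  have hfm : Measurable f := .of_discrete
  have hi := SimpleFunc.integrable_approxOn_range hfm hf
  have ht := SimpleFunc.tendsto_approxOn_range_L1_enorm hfm hf
  generalize SimpleFunc.approxOn f hfm (Set.range f ∪ {0}) 0 (by simp) = s at hi ht
  have ht1 : Tendsto (fun n => (hi n).toL1 (s n)) atTop (𝓝 (hf.toL1 f)) := by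
    rw [tendsto_iff_edist_tendsto_0]
    refine ht.congr fun n => ?_
    rw [Integrable.edist_toL1_toL1]
    simp [edist_eq_enorm_sub]
  refine ⟨fun n => s n, fun n => (s n).finite_range, fun ε hε => ?_, ?_⟩
  · have h : TendstoInMeasure μ (fun n => s n) atTop f :=
      (tendstoInMeasure_of_tendsto_Lp ht1).congr (fun n => (hi n).coeFn_toL1) hf.coeFn_toL1
    rw [tendstoInMeasure_iff_measureReal_norm] at h
    refine squeeze_zero (fun n => m.nonneg _) (fun n => ?_) (h ε hε)
    rw [hm]
    exact measureReal_mono fun ω (hω : ε < _) => hω.le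
  · have hc := cauchySeq_iff_tendsto_dist_atTop_0.1 ht1.cauchySeq
    refine hc.congr fun p => ?_
    rw [dist_toL1, simpleIntegral_eq hm (finite_range_abs_sub (s _).finite_range (s _).finite_range)]

theorem integrable_iff (hm : ∀ A, m.toFun A = μ.real A) {f : Ω → ℝ} :
    m.Integrable f ↔ MeasureTheory.Integrable f μ :=
  ⟨fun ⟨_, hs⟩ => (hs.integrable_and_tendsto hm).1, exists_determines hm⟩

theorem integral_eq_integral (hm : ∀ A, m.toFun A = μ.real A) {f : Ω → ℝ}
    (hf : MeasureTheory.Integrable f μ) : m.integral f = ∫ ω, f ω ∂μ := by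
  obtain ⟨s, hs⟩ := exists_determines hm hf
  have h : ∃ I, m.HasIntegral f I := ⟨_, s, hs, (hs.integrable_and_tendsto hm).2⟩
  rw [integral, dif_pos h]
  obtain ⟨t, ht, ht'⟩ := h.choose_spec
  exact tendsto_nhds_unique ht' (ht.integrable_and_tendsto hm).2

end FinAddProb

end

/-! ### Calculus of `≥_*` and the vector space `L(X)`. -/

namespace CommonOrder

variable {Ω : Type*} {O : CommonOrder Ω} {X : Set (Ω → ℝ)}

theorem ge_add_right {f g : Ω → ℝ} (h : O.ge f g) (k : Ω → ℝ) : O.ge (f + k) (g + k) := by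
  simpa using O.affine f g 1 k zero_le_one ⟨1, fun _ => le_rfl⟩ h

theorem ge_add {f g f' g' : Ω → ℝ} (h : O.ge f g) (h' : O.ge f' g') : O.ge (f + f') (g + g') := by
  refine O.trans _ _ _ (ge_add_right h f') ?_
  simpa only [add_comm] using ge_add_right h' g

theorem ge_smul {f g : Ω → ℝ} {c : ℝ} (hc : 0 ≤ c) (h : O.ge f g) : O.ge (c • f) (c • g) := by
  have := O.affine f g (fun _ => c) 0 (fun _ => hc) ⟨c, fun _ => le_rfl⟩ h
  rw [add_zero, add_zero] at this
  exact this

theorem ge_sub_zero {f g : Ω → ℝ} (h : O.ge f g) : O.ge (f - g) 0 := by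
  simpa [sub_eq_add_neg] using ge_add_right h (-g)

/-- Multiply `f ≥_* 0` by the bounded function `1_{f < 0}` and add the negative part of `f`. -/
theorem zero_ge_neg_part {f : Ω → ℝ} (h : O.ge f 0) : O.ge 0 (fun ω => max (-f ω) 0) := by
  classical
  have := O.affine f 0 ({ω | f ω < 0}.indicator 1) (fun ω => max (-f ω) 0)
    (Set.indicator_nonneg fun _ _ => zero_le_one)
    ⟨1, fun ω => Set.indicator_le_self' (fun _ _ => zero_le_one) ω⟩ h
  convert this using 1
  · ext ω
    by_cases hω : f ω < 0
    · simp [hω, max_eq_left (by linarith : (0 : ℝ) ≤ -f ω)]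
    · simp [hω, not_lt.1 hω]
  · simp

theorem negligible_lt_neg {f : Ω → ℝ} (h : O.ge f 0) {ε : ℝ} (hε : 0 < ε) :
    O.Negligible {ω | f ω < -ε} := by
  have h1 : O.ge 0 (ε • ({ω | f ω < -ε}.indicator 1 : Ω → ℝ)) := by
    refine O.trans _ _ _ (zero_ge_neg_part h) (O.mono _ _ fun ω => ?_)
    by_cases hω : f ω < -ε
    · simpa [hω] using Or.inl (by linarith)
    · simp [hω]
  have h2 := ge_smul (inv_nonneg.2 hε.le) h1
  rwa [smul_zero, inv_smul_smul₀ hε.ne'] at h2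

theorem ge_abs {f : Ω → ℝ} (h : O.ge f 0) : O.ge f |f| := by
  have := ge_add (O.refl f) (ge_smul zero_le_two (zero_ge_neg_part h))
  rw [smul_zero, add_zero] at this
  convert this using 1
  ext ω
  rcases le_total 0 (f ω) with h0 | h0
  · simp [abs_of_nonneg h0, h0]
  · simp [abs_of_nonpos h0, h0]; ring

theorem ge_inf_zero {f g : Ω → ℝ} (h : O.ge f 0) (hg : 0 ≤ g) : O.ge (f ⊓ g) 0 := by
  refine O.trans _ ((-1 : ℝ) • fun ω => max (-f ω) 0) _ (O.mono _ _ fun ω => ?_) ?_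
  · have := hg ω
    simp only [Pi.zero_apply, Pi.smul_apply, smul_eq_mul, Pi.inf_apply, le_inf_iff] at *
    constructor
    · linarith [le_max_left (-f ω) 0]
    · linarith [le_max_right (-f ω) 0]
  · have := ge_add_right (zero_ge_neg_part h) ((-1 : ℝ) • fun ω => max (-f ω) 0)
    rw [zero_add] at this
    convert this using 1
    ext ω
    simp

theorem mem_L_of_abs_le {f g : Ω → ℝ} (hf : f ∈ O.L X) (h : O.ge |f| |g|) : g ∈ O.L X := by
  obtain ⟨c, hc, k, hk, hkf⟩ := hf
  exact ⟨c, hc, k, hk, O.trans _ _ _ hkf h⟩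

theorem smul_mem_L {f : Ω → ℝ} (c : ℝ) (hf : f ∈ O.L X) : c • f ∈ O.L X := by
  obtain ⟨d, hd, k, hk, hkf⟩ := hf
  refine ⟨(|c| + 1) * d, by positivity, k, hk, ?_⟩
  rw [mul_smul]
  refine O.trans _ _ _ (ge_smul (by positivity) hkf) (O.mono _ _ fun ω => ?_)
  simp only [Pi.abs_apply, Pi.smul_apply, smul_eq_mul, abs_mul]
  gcongr
  linarith

namespace IsMarket


theorem add_mem_L (hX : O.IsMarket X) {f g : Ω → ℝ} (hf : f ∈ O.L X) (hg : g ∈ O.L X) : f + g ∈ O.L X := by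
  obtain ⟨c, hc, k, hk, hkf⟩ := hf
  obtain ⟨d, hd, l, hl, hlg⟩ := hg
  -- `X` is only convex, so `c k + d l` is written as `c + d` times a convex combination.
  refine ⟨c + d, by positivity, (c / (c + d)) • k + (d / (c + d)) • l,
    hX.convex hk hl (by positivity) (by positivity) (by field_simp), ?_⟩
  have h := O.trans _ _ _ (ge_add hkf hlg) (O.mono _ |f + g| fun ω => abs_add_le (f ω) (g ω))
  convert h using 1
  rw [smul_add, smul_smul, smul_smul, mul_div_cancel₀ _ (by positivity),
    mul_div_cancel₀ _ (by positivity)]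

/-- The complete market as a vector space. -/
def space (hX : O.IsMarket X) : Submodule ℝ (Ω → ℝ) where
  carrier := O.L X
  add_mem' := hX.add_mem_L
  zero_mem' := ⟨1, one_pos, 0, hX.zero_mem, by simpa using O.refl 0⟩
  smul_mem' := fun c _ hf => smul_mem_L c hf

theorem mem_L_of_bounded (hX : O.IsMarket X) {f : Ω → ℝ} {C : ℝ} (hf : ∀ ω, |f ω| ≤ C) : f ∈ O.L X := by
  refine ⟨|C| + 1, by positivity, 1, hX.one_mem, O.mono _ _ fun ω => ?_⟩
  simpa using (hf ω).trans ((le_abs_self C).trans (by linarith))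

theorem const_mem_L (hX : O.IsMarket X) (a : ℝ) : (fun _ => a) ∈ O.L X := hX.mem_L_of_bounded fun _ => le_rfl

/-- Shifting `f` up by `|a|` makes it `≥_* 0`, hence `≥_*` its own absolute value; constants lie in
`L(X)` and can be subtracted again. -/
theorem subset_L (hX : O.IsMarket X) : X ⊆ O.L X := by
  intro f hf
  obtain ⟨a, ha⟩ := hX.bddBelow f hf
  have hk := hX.add_const_mem f hf |a| (abs_nonneg a)
  have h0 : O.ge (fun ω => f ω + |a|) 0 := by
    refine O.trans _ _ _ (ge_add_right ha fun _ => |a|) (O.mono _ _ fun ω => ?_)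
    simpa [add_comm] using neg_le_iff_add_nonneg'.1 (neg_abs_le a)
  have h1 : (fun ω => f ω + |a|) ∈ O.L X := ⟨1, one_pos, _, hk, by simpa using ge_abs h0⟩
  have h2 := hX.add_mem_L h1 (hX.const_mem_L (-|a|))
  convert h2 using 1
  ext ω
  simp

end IsMarket

end CommonOrder

/-! ### A Hahn–Banach sandwich theorem. -/

/-- The cone `S` is the epigraph of `ρ` minus `K`. As `K` lies below the graph of `ρ`, `(0, t) ∈ S`
forces `t ≥ 0`, so the Riesz extension theorem extends `(0, t) ↦ t` to a functional `g` nonnegative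
on `S`. Then `φ x = -g (x, 0)`. -/
theorem exists_linear_between {E : Type*} [AddCommGroup E] [Module ℝ E] (ρ : E → ℝ)
    (ρ_hom : ∀ c : ℝ, 0 < c → ∀ x, ρ (c • x) = c * ρ x)
    (ρ_add : ∀ x y, ρ (x + y) ≤ ρ x + ρ y) (K : PointedCone ℝ (E × ℝ))
    (hK : ∀ p ∈ K, p.2 ≤ ρ p.1) :
    ∃ φ : E →ₗ[ℝ] ℝ, (∀ x, φ x ≤ ρ x) ∧ ∀ p ∈ K, p.2 ≤ φ p.1 := by
  have ρ_zero : ρ 0 = 0 := by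
    have := ρ_hom 2 two_pos 0
    rw [smul_zero] at this
    linarith
  let S : PointedCone ℝ (E × ℝ) :=
    { carrier := {p | ∃ q ∈ K, ρ (p.1 + q.1) ≤ p.2 + q.2}
      zero_mem' := ⟨0, K.zero_mem, by simp [ρ_zero]⟩
      add_mem' := by
        rintro p p' ⟨q, hq, h⟩ ⟨q', hq', h'⟩
        refine ⟨q + q', K.add_mem hq hq', ?_⟩
        have := ρ_add (p.1 + q.1) (p'.1 + q'.1)
        simp only [Prod.fst_add, Prod.snd_add]
        rw [add_add_add_comm]
        linarith
      smul_mem' := by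
        rintro ⟨c, hc⟩ p ⟨q, hq, h⟩
        refine ⟨c • q, K.smul_mem hc hq, ?_⟩
        change ρ (c • p.1 + c • q.1) ≤ c * p.2 + c * q.2
        rcases hc.eq_or_lt with rfl | hc
        · simp [ρ_zero]
        · rw [← smul_add, ρ_hom c hc, ← mul_add]
          gcongr }
  let f : (E × ℝ) →ₗ.[ℝ] ℝ := ⟨LinearMap.ker (LinearMap.fst ℝ E ℝ), (LinearMap.snd ℝ E ℝ).domRestrict _⟩
  obtain ⟨g, hg, hgS⟩ := riesz_extension S f
    (by
      rintro ⟨⟨x, t⟩, hx⟩ ⟨q, hq, h⟩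
      have hx : x = 0 := hx
      subst hx
      change 0 ≤ t
      have := hK q hq
      simp only [zero_add] at h
      linarith)
    (by
      rintro ⟨x, t⟩
      refine ⟨⟨(0, ρ x - t), LinearMap.mem_ker.2 rfl⟩, 0, K.zero_mem, ?_⟩
      change ρ (0 + x + 0) ≤ ρ x - t + t + 0
      simp)
  have hg1 : ∀ t : ℝ, g (0, t) = t := fun t => hg ⟨(0, t), LinearMap.mem_ker.2 rfl⟩
  refine ⟨-(g.comp (LinearMap.inl ℝ E ℝ)), fun x => ?_, fun p hp => ?_⟩
  · change -g (x, 0) ≤ ρ x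
    have h1 := hgS (x, ρ x) ⟨0, K.zero_mem, show ρ (x + 0) ≤ ρ x + 0 by simp⟩
    have h2 : g (x, ρ x) = g (x, 0) + g (0, ρ x) := by
      rw [← map_add, Prod.mk_add_mk, add_zero, zero_add]
    rw [h2, hg1] at h1
    linarith
  · change p.2 ≤ -g (p.1, 0)
    have h1 := hgS (-p) ⟨p, hp, show ρ (-p.1 + p.1) ≤ -p.2 + p.2 by simp [ρ_zero]⟩
    have h2 : g p = g (p.1, 0) + g (0, p.2) := by
      rw [← map_add, Prod.mk_add_mk, add_zero, zero_add]
    rw [map_neg, h2, hg1] at h1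
    linarith

/-- A sublinear functional `ρ` that is nearly superadditive on a class `P` dominates
a linear functional which is comparable with `ρ` on `P`. -/
theorem exists_linear_ge_on {E : Type*} [AddCommGroup E] [Module ℝ E] (ρ : E → ℝ)
    (ρ_hom : ∀ c : ℝ, 0 < c → ∀ x, ρ (c • x) = c * ρ x)
    (ρ_add : ∀ x y, ρ (x + y) ≤ ρ x + ρ y) (P : E → Prop) 
    (P_smul : ∀ c : ℝ, 0 < c → ∀ x, P x → P (c • x)) (δ : ℝ)
    (hP : ∀ l : List E, (∀ x ∈ l, P x) → δ * (l.map ρ).sum ≤ ρ l.sum) :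
    ∃ φ : E →ₗ[ℝ] ℝ, (∀ x, φ x ≤ ρ x) ∧ ∀ x, P x → δ * ρ x ≤ φ x := by
  -- Lists make sums in this cone concatenations; `hP` says precisely that it lies below the graph
  -- of `ρ`.
  let K : PointedCone ℝ (E × ℝ) :=
    { carrier := {p | ∃ l : List E, (∀ x ∈ l, P x) ∧ p = (l.sum, δ * (l.map ρ).sum)}
      zero_mem' := ⟨[], by simp, by simp; rfl⟩
      add_mem' := by
        rintro _ _ ⟨l, hl, rfl⟩ ⟨l', hl', rfl⟩
        refine ⟨l ++ l', fun x hx => (List.mem_append.1 hx).elim (hl x) (hl' x), ?_⟩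
        simp [mul_add]
      smul_mem' := by
        rintro ⟨c, hc⟩ _ ⟨l, hl, rfl⟩
        rcases hc.eq_or_lt with rfl | hc'
        · refine ⟨[], by simp, ?_⟩
          rw [List.map_nil, List.sum_nil, List.sum_nil, mul_zero]
          exact zero_smul ℝ (l.sum, δ * (l.map ρ).sum)
        · refine ⟨l.map (c • ·), by simpa using fun x hx => P_smul c hc' x (hl x hx), ?_⟩
          change (c • l.sum, c * (δ * (l.map ρ).sum)) = _
          rw [List.map_map, List.smul_sum, show ρ ∘ (c • ·) = fun x => c * ρ x from
            funext fun x => ρ_hom c hc' x, List.sum_map_mul_left]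
          ring_nf }
  obtain ⟨φ, h1, h2⟩ := exists_linear_between ρ ρ_hom ρ_add K (by
    rintro _ ⟨l, hl, rfl⟩
    exact hP l hl)
  exact ⟨φ, h1, fun x hx => by simpa using h2 (x, δ * ρ x) ⟨[x], by simpa using hx, by simp⟩⟩

/-! ### Bounds on `ma_c` as inequalities for sums. -/

theorem BoundedSumSeq.partialSum_le {Ω : Type*} {ρ : (Ω → ℝ) → ℝ}
    (hρ : ∀ g : Ω → ℝ, 0 ≤ g → (∃ C : ℝ, ∀ ω, g ω ≤ C) → 0 ≤ ρ g) {f : ℕ → Ω → ℝ}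
    (hf : BoundedSumSeq f) {j k : ℕ} (hjk : j ≤ k) :
    ∑ n ∈ Finset.range j, ρ (f n) ≤ ∑ n ∈ Finset.range k, ρ (f n) :=
  Finset.sum_le_sum_of_subset_of_nonneg (Finset.range_mono hjk) fun n _ _ =>
    hρ _ (hf.nonneg n) (hf.bounded n)

theorem BoundedSumSeq.sum_nonneg {Ω : Type*} {f : ℕ → Ω → ℝ} (hf : BoundedSumSeq f) :
    0 ≤ fun ω => ∑' n, f n ω := fun ω => tsum_nonneg fun n => hf.nonneg n ω

theorem BoundedSumSeq.tendsto_macPartial {Ω : Type*} {ρ : (Ω → ℝ) → ℝ}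
    (hρ : ∀ g : Ω → ℝ, 0 ≤ g → (∃ C : ℝ, ∀ ω, g ω ≤ C) → 0 ≤ ρ g) {f : ℕ → Ω → ℝ}
    (hf : BoundedSumSeq f) : Tendsto (macPartial ρ f) atTop (𝓝 (macSeq ρ f)) :=
  tendsto_macSeq ρ f (fun n => hρ _ (hf.nonneg n) (hf.bounded n)) (hρ _ hf.sum_nonneg hf.sum_bounded)

/-- A real lower bound `x` for all `macSeq ρ f` reads `1 - ρ (∑ fₙ) / a > x` for some partial sum
`a`, whence the constant `1 - x`. If `a = 0`, the value `-∞` of the quotient is excluded, so `ρ (∑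
fₙ) = 0`. -/
theorem exists_le_mul_tsum_of_nac_lt_top {Ω : Type*} {ρ : (Ω → ℝ) → ℝ}
    (hρ : ∀ g : Ω → ℝ, 0 ≤ g → (∃ C : ℝ, ∀ ω, g ω ≤ C) → 0 ≤ ρ g) (h : nac ρ < ⊤) :
    ∃ K : ℝ, ∀ f : ℕ → Ω → ℝ, BoundedSumSeq f → Summable (fun n => ρ (f n)) →
      ρ (fun ω => ∑' n, f n ω) ≤ K * ∑' n, ρ (f n) := by
  have hbot : ⊥ < ⨅ (f : ℕ → Ω → ℝ) (_ : BoundedSumSeq f), macSeq ρ f := by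
    rw [bot_lt_iff_ne_bot]
    intro h'
    rw [nac, h'] at h
    simp at h
  obtain ⟨x, -, hx⟩ := EReal.lt_iff_exists_real_btwn.1 hbot
  refine ⟨max (1 - x) 0, fun f hf hs => ?_⟩
  have h1 : (x : EReal) < macSeq ρ f := hx.trans_le (iInf₂_le f hf)
  obtain ⟨k, hk⟩ := ((hf.tendsto_macPartial hρ).eventually (lt_mem_nhds h1)).exists
  have h0 := hf.partialSum_le hρ (Nat.zero_le k)
  rw [Finset.range_zero, Finset.sum_empty] at h0
  have hk' : ∑ n ∈ Finset.range k, ρ (f n) ≤ ∑' n, ρ (f n) :=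
    hs.sum_le_tsum _ fun n _ => hρ _ (hf.nonneg n) (hf.bounded n)
  have hS := hρ _ hf.sum_nonneg hf.sum_bounded
  refine le_trans ?_ (mul_le_mul_of_nonneg_left hk' (le_max_right _ _))
  unfold macPartial at hk
  generalize ∑ n ∈ Finset.range k, ρ (f n) = a at *
  generalize ρ (fun ω => ∑' n, f n ω) = S at *
  unfold extDiv at hk
  rcases h0.eq_or_lt with rfl | ha
  · rcases hS.eq_or_lt with rfl | hS
    · simp
    · rw [if_pos rfl, if_neg (by linarith), if_neg (by linarith)] at hk
      exact absurd hk not_lt_bot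
  · rw [if_neg ha.ne', EReal.coe_lt_coe_iff, lt_div_iff₀ ha] at hk
    have := mul_le_mul_of_nonneg_right (le_max_left (1 - x) 0) ha.le
    linarith

/-- With a real `x` strictly between `mac ρ` and `1`, a late quotient below `x` rearranges to the
claim with `δ = 1 - x`. -/
theorem exists_mul_sum_le_of_mac_lt_one {Ω : Type*} {ρ : (Ω → ℝ) → ℝ}
    (hρ : ∀ g : Ω → ℝ, 0 ≤ g → (∃ C : ℝ, ∀ ω, g ω ≤ C) → 0 ≤ ρ g) (h : mac ρ < 1) :
    ∃ δ : ℝ, 0 < δ ∧ ∀ f : ℕ → Ω → ℝ, BoundedSumSeq f → ∀ k,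
      δ * ∑ n ∈ Finset.range k, ρ (f n) ≤ ρ (fun ω => ∑' n, f n ω) := by
  obtain ⟨x, hx, hx1⟩ := EReal.lt_iff_exists_real_btwn.1 h
  have hx1 : x < 1 := by exact_mod_cast hx1
  refine ⟨1 - x, by linarith, fun f hf k => ?_⟩
  have h1 : macSeq ρ f < x := (le_iSup₂ (f := fun f (_ : BoundedSumSeq f) => macSeq ρ f) f hf).trans_lt hx
  obtain ⟨j, hj, hkj⟩ := (((hf.tendsto_macPartial hρ).eventually (gt_mem_nhds h1)).and
    (eventually_ge_atTop k)).exists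
  have h0 := hf.partialSum_le hρ (Nat.zero_le j)
  rw [Finset.range_zero, Finset.sum_empty] at h0
  have hS := hρ _ hf.sum_nonneg hf.sum_bounded
  refine (mul_le_mul_of_nonneg_left (hf.partialSum_le hρ hkj) (by linarith)).trans ?_
  unfold macPartial at hj
  generalize ∑ n ∈ Finset.range j, ρ (f n) = a at *
  generalize ρ (fun ω => ∑' n, f n ω) = S at *
  unfold extDiv at hj
  rcases h0.eq_or_lt with rfl | ha
  · simpa using hS
  · rw [if_neg ha.ne', EReal.coe_lt_coe_iff, div_lt_iff₀ ha] at hj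
    linarith

theorem macSeq_eq_zero_of_hasSum {Ω : Type*} {ρ : (Ω → ℝ) → ℝ} {f : ℕ → Ω → ℝ}
    (hf : ∀ n, 0 ≤ ρ (f n)) (h : HasSum (fun n => ρ (f n)) (ρ fun ω => ∑' n, f n ω)) :
    macSeq ρ f = 0 := by
  refine Tendsto.limUnder_eq ?_
  unfold macPartial
  generalize ρ (fun ω => ∑' n, f n ω) = S at *
  rcases (h.nonneg hf).eq_or_lt with rfl | hS
  · have h0 := (hasSum_zero_iff_of_nonneg hf).1 h
    have h1 : ∀ n, ρ (f n) = 0 := fun n => congrFun h0 n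
    simp [h1, extDiv]
  · have ht := h.tendsto_sum_nat
    have h2 : Tendsto (fun k => (((∑ n ∈ Finset.range k, ρ (f n)) - S) /
        (∑ n ∈ Finset.range k, ρ (f n)) : ℝ)) atTop (𝓝 0) := by
      have := (ht.sub_const S).div ht hS.ne'
      rwa [sub_self, zero_div] at this
    refine ((continuous_coe_real_ereal.tendsto 0).comp h2).congr' ?_
    filter_upwards [ht.eventually (lt_mem_nhds hS)] with k hk
    simp [extDiv, hk.ne']

theorem List.sum_range_getD {E : Type*} [AddCommMonoid E] (g : E → ℝ) (l : List E) :
    ∑ n ∈ Finset.range l.length, g (l.getD n 0) = (l.map g).sum := by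
  induction l with
  | nil => simp
  | cons a l ih => simp [Finset.sum_range_succ', ← ih, add_comm]

/-- Padding with zeros turns a finite list into an admissible sequence, so bounds on `ma_c` apply to
finite sums. -/
theorem boundedSumSeq_getD {Ω : Type*} {l : List (Ω → ℝ)}
    (hl : ∀ g ∈ l, 0 ≤ g ∧ ∃ C : ℝ, ∀ ω, g ω ≤ C) :
    BoundedSumSeq (fun n => l.getD n 0) ∧ (fun ω => ∑' n, l.getD n 0 ω) = l.sum := by
  have h : ∀ n, 0 ≤ l.getD n 0 ∧ ∃ C : ℝ, ∀ ω, l.getD n 0 ω ≤ C := by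
    intro n
    by_cases hn : n < l.length
    · rw [List.getD_eq_getElem l 0 hn]
      exact hl _ (List.getElem_mem hn)
    · rw [List.getD_eq_default l 0 (not_lt.1 hn)]
      exact ⟨le_rfl, 0, fun _ => le_rfl⟩
  have h0 : ∀ ω, ∀ n ∉ Finset.range l.length, l.getD n 0 ω = 0 := by
    intro ω n hn
    rw [List.getD_eq_default l 0 (by simpa using hn)]
    rfl
  have hsum : (fun ω => ∑' n, l.getD n 0 ω) = l.sum := by
    ext ω
    rw [tsum_eq_sum (h0 ω), List.sum_range_getD (fun g : Ω → ℝ => g ω)]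
    exact (map_list_sum (Pi.evalAddMonoidHom (fun _ : Ω => ℝ) ω) l).symm
  refine ⟨⟨fun n => (h n).1, fun n => (h n).2,
    fun ω => summable_of_ne_finset_zero (h0 ω), ?_⟩, hsum⟩
  have hb : ∀ l : List (Ω → ℝ), (∀ g ∈ l, 0 ≤ g ∧ ∃ C : ℝ, ∀ ω, g ω ≤ C) →
      ∃ C : ℝ, ∀ ω, l.sum ω ≤ C := by
    intro l
    induction l with
    | nil => exact fun _ => ⟨0, fun _ => le_rfl⟩
    | cons a l ih =>
      intro hl
      obtain ⟨C, hC⟩ := ih fun g hg => hl g (List.mem_cons_of_mem a hg)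
      obtain ⟨-, D, hD⟩ := hl a List.mem_cons_self
      exact ⟨D + C, fun ω => by simpa using add_le_add (hD ω) (hC ω)⟩
  obtain ⟨C, hC⟩ := hb l hl
  exact ⟨C, fun ω => (congrFun hsum ω).trans_le (hC ω)⟩

theorem hasSum_indicator_iUnion {Ω : Type*} {A : ℕ → Set Ω}
    (hA : Pairwise (Function.onFun Disjoint A)) (ω : Ω) :
    HasSum (fun n => (A n).indicator (1 : Ω → ℝ) ω) ((⋃ n, A n).indicator 1 ω) := by
  by_cases h : ω ∈ ⋃ n, A n
  · obtain ⟨i, hi⟩ := Set.mem_iUnion.1 h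
    have h1 : (⋃ n, A n).indicator (1 : Ω → ℝ) ω = (A i).indicator 1 ω := by simp [h, hi]
    rw [h1]
    refine hasSum_single i fun n hn => Set.indicator_of_notMem ?_ _
    exact fun hn' => Set.disjoint_left.1 (hA hn) hn' hi
  · have h1 : ∀ n, ω ∉ A n := fun n hn => h (Set.mem_iUnion.2 ⟨n, hn⟩)
    simp [h, h1, hasSum_zero]

theorem indicator_one_bounds {Ω : Type*} (A : Set Ω) :
    0 ≤ A.indicator (1 : Ω → ℝ) ∧ ∀ ω, A.indicator (1 : Ω → ℝ) ω ≤ 1 :=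
  ⟨Set.indicator_nonneg fun _ _ => zero_le_one,
    fun ω => Set.indicator_le_self' (fun _ _ => zero_le_one) ω⟩

theorem boundedSumSeq_indicator {Ω : Type*} {A : ℕ → Set Ω}
    (hA : Pairwise (Function.onFun Disjoint A)) :
    BoundedSumSeq (fun n => (A n).indicator (1 : Ω → ℝ)) :=
  ⟨fun n => (indicator_one_bounds (A n)).1, fun n => ⟨1, (indicator_one_bounds (A n)).2⟩,
    fun ω => (hasSum_indicator_iUnion hA ω).summable,
    1, fun ω => (hasSum_indicator_iUnion hA ω).tsum_eq.trans_le ((indicator_one_bounds _).2 ω)⟩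

/-! ### Measures that vanish on negligible sets. -/

section

open MeasureTheory

namespace CommonOrder

variable {Ω : Type*} {O : CommonOrder Ω} {X : Set (Ω → ℝ)} {π ρ : (Ω → ℝ) → ℝ}

section Measure

variable [MeasurableSpace Ω] {μ : Measure Ω}

/-- Each `{f < -ε}` is negligible; countable additivity of `μ` passes to `{f < 0}`. -/
theorem ae_nonneg (hμ : ∀ A, O.Negligible A → μ A = 0) {f : Ω → ℝ} (h : O.ge f 0) :
    0 ≤ᵐ[μ] f := by
  have h1 : ∀ n : ℕ, ∀ᵐ ω ∂μ, -(1 / ((n : ℝ) + 1)) ≤ f ω := by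
    intro n
    rw [ae_iff]
    simpa only [not_le] using hμ _ (negligible_lt_neg h Nat.one_div_pos_of_nat)
  filter_upwards [ae_all_iff.2 h1] with ω hω
  have h2 : Tendsto (fun n : ℕ => -(1 / ((n : ℝ) + 1))) atTop (𝓝 0) := by
    simpa using (tendsto_one_div_add_atTop_nhds_zero_nat (𝕜 := ℝ)).neg
  exact le_of_tendsto' h2 hω

theorem ae_le (hμ : ∀ A, O.Negligible A → μ A = 0) {f g : Ω → ℝ} (h : O.ge f g) :
    g ≤ᵐ[μ] f := by
  filter_upwards [ae_nonneg hμ (ge_sub_zero h)] with ω hω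
  simpa using hω

theorem isPricing_integral [IsProbabilityMeasure μ] (hμ : ∀ A, O.Negligible A → μ A = 0)
    {D : Set (Ω → ℝ)} (hD : ∀ f ∈ D, Integrable f μ) :
    O.IsPricing D fun f => ∫ ω, f ω ∂μ where
  posHom f _ c _ _ := integral_const_mul c f
  subadd f hf g hg _ := (integral_add (hD f hf) (hD g hg)).le
  map_one := by simp
  mono f hf g hg h := integral_mono_ae (hD g hg) (hD f hf) (ae_le hμ h)

theorem hasSum_integral_of_boundedSumSeq [DiscreteMeasurableSpace Ω] [IsProbabilityMeasure μ]
    {f : ℕ → Ω → ℝ} (hf : BoundedSumSeq f) :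
    HasSum (fun n => ∫ ω, f n ω ∂μ) (∫ ω, ∑' n, f n ω ∂μ) := by
  obtain ⟨C, hC⟩ := hf.sum_bounded
  -- The nonnegative terms serve as their own bounds; their sum is bounded, hence integrable.
  refine hasSum_integral_of_dominated_convergence f
    (fun n => Measurable.of_discrete.aestronglyMeasurable)
    (fun n => ae_of_all _ fun ω => (Real.norm_of_nonneg (hf.nonneg n ω)).le)
    (ae_of_all _ hf.summable) ?_ (ae_of_all _ fun ω => (hf.summable ω).hasSum)
  refine Integrable.of_bound Measurable.of_discrete.aestronglyMeasurable C (ae_of_all _ fun ω => ?_)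
  rw [Real.norm_of_nonneg (hf.sum_nonneg ω)]
  exact hC ω

theorem mac_integral_le [DiscreteMeasurableSpace Ω] [IsProbabilityMeasure μ] :
    nac (fun f => ∫ ω, f ω ∂μ) ≤ 0 ∧ mac (fun f => ∫ ω, f ω ∂μ) ≤ 0 := by
  have h : ∀ f : ℕ → Ω → ℝ, BoundedSumSeq f → macSeq (fun f => ∫ ω, f ω ∂μ) f = 0 := fun f hf =>
    macSeq_eq_zero_of_hasSum (fun n => integral_nonneg (hf.nonneg n))
      (hasSum_integral_of_boundedSumSeq hf)
  constructor
  · rw [nac, EReal.neg_le, neg_zero]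
    exact le_iInf₂ fun f hf => (h f hf).ge
  · exact iSup₂_le fun f hf => (h f hf).le

theorem simpleFunc_apply_eq_integral [IsProbabilityMeasure μ] (ψ : (Ω → ℝ) →ₗ[ℝ] ℝ)
    (hψ : ∀ A : Set Ω, ψ (A.indicator 1) = μ.real A) (s : SimpleFunc Ω ℝ) :
    ψ s = ∫ ω, s ω ∂μ := by
  have h : (s : Ω → ℝ) = ∑ y ∈ s.range, y • (s ⁻¹' {y}).indicator (1 : Ω → ℝ) := by
    ext ω
    rw [Finset.sum_apply, Finset.sum_eq_single (s ω)]
    · simp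
    · intro y _ hy
      simp [hy.symm]
    · simp
  rw [SimpleFunc.integral_eq_sum s (SimpleFunc.integrable_of_isFiniteMeasure s)]
  conv_lhs => rw [h]
  rw [map_sum]
  refine Finset.sum_congr rfl fun y _ => ?_
  rw [map_smul, hψ, smul_eq_mul, smul_eq_mul, mul_comm]

/-- `ψ` agrees with the integral on simple functions and is monotone, so `ψ g` dominates the
integral of every simple function below the positive part of `g`, and therefore their supremum. -/
theorem integrable_and_integral_le [DiscreteMeasurableSpace Ω] [IsProbabilityMeasure μ]
    (hX : O.IsMarket X) (hμ : ∀ A, O.Negligible A → μ A = 0) (ψ : (Ω → ℝ) →ₗ[ℝ] ℝ)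
    (hψ : ∀ A : Set Ω, ψ (A.indicator 1) = μ.real A)
    (hpos : ∀ g ∈ O.L X, O.ge g 0 → 0 ≤ ψ g) {g : Ω → ℝ} (hg : g ∈ O.L X) (h0 : O.ge g 0) :
    Integrable g μ ∧ ∫ ω, g ω ∂μ ≤ ψ g := by
  have key : ∫⁻ ω, ENNReal.ofReal (g ω) ∂μ ≤ ENNReal.ofReal (ψ g) := by
    rw [lintegral_eq_nnreal]
    refine iSup₂_le fun s hs => ?_
    let t : SimpleFunc Ω ℝ := s.map (fun x : NNReal => (x : ℝ))
    have ht : O.ge g t := by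
      -- `g` may be negative at some points, so the comparison goes through `g ≥_* |g|`.
      refine O.trans _ _ _ (ge_abs h0) (O.mono _ _ fun ω => ?_)
      have h1 := hs ω
      change (s ω : ℝ) ≤ |g ω|
      rw [ENNReal.ofReal, ENNReal.coe_le_coe] at h1
      refine (NNReal.coe_le_coe.2 h1).trans ?_
      rw [Real.coe_toNNReal']
      exact max_le (le_abs_self _) (abs_nonneg _)
    have htL : (t : Ω → ℝ) ∈ O.L X := by
      refine mem_L_of_abs_le hg (O.trans _ _ _ (O.mono _ g fun ω => le_abs_self _) ?_)
      convert ht using 1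
      ext ω
      exact abs_of_nonneg (s ω).2
    have h2 : ψ t ≤ ψ g := by
      have := hpos (g - t) (hX.space.sub_mem hg htL) (ge_sub_zero ht)
      rw [map_sub] at this
      linarith
    rw [simpleFunc_apply_eq_integral ψ hψ] at h2
    rw [← SimpleFunc.lintegral_eq_lintegral]
    refine le_trans (le_of_eq ?_) (ENNReal.ofReal_le_ofReal h2)
    rw [ofReal_integral_eq_lintegral_ofReal (SimpleFunc.integrable_of_isFiniteMeasure t)
      (ae_of_all _ fun ω => (s ω).2)]
    refine lintegral_congr fun ω => ?_
    simp [t]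
  have hae := ae_nonneg hμ h0
  have hfin : ∫⁻ ω, ENNReal.ofReal (g ω) ∂μ < ⊤ := key.trans_lt ENNReal.ofReal_lt_top
  refine ⟨⟨Measurable.of_discrete.aestronglyMeasurable,
    (hasFiniteIntegral_iff_ofReal hae).2 hfin⟩, ?_⟩
  rw [integral_eq_lintegral_of_nonneg_ae hae Measurable.of_discrete.aestronglyMeasurable]
  exact ENNReal.toReal_le_of_le_ofReal (hpos g hg h0) key

end Measure

namespace IsMarket

/-- The measure is `A ↦ ψ (1_A)`. The inequality `∫ g ≤ ψ g` is used for `g = f - a`, which bounds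
`∫ f` by `ψ f` on `X`, and for `g = 1 - f`, which reverses it when `f ≤ 1`. -/
theorem exists_pricingMeasure (hX : O.IsMarket X) (ψ : (Ω → ℝ) →ₗ[ℝ] ℝ) (hψ1 : ψ 1 = 1)
    (hpos : ∀ g ∈ O.L X, O.ge g 0 → 0 ≤ ψ g) (hle : ∀ f ∈ X, ψ f ≤ π f)
    (hσ : ∀ A : ℕ → Set Ω, Pairwise (Function.onFun Disjoint A) →
      HasSum (fun n => ψ ((A n).indicator 1)) (ψ ((⋃ n, A n).indicator 1))) :
    ∃ m ∈ O.M₀ X π, m.CountablyAdditive ∧ ∀ f ∈ O.L X, f ≤ 1 → ψ f ≤ m.integral f := by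
  have hind : ∀ A : Set Ω, A.indicator (1 : Ω → ℝ) ∈ O.L X := fun A =>
    hX.mem_L_of_bounded (C := 1) fun ω => by
      rw [abs_of_nonneg ((indicator_one_bounds A).1 ω)]
      exact (indicator_one_bounds A).2 ω
  have hind0 : ∀ A : Set Ω, 0 ≤ ψ (A.indicator 1) := fun A =>
    hpos _ (hind A) (O.mono _ _ (indicator_one_bounds A).1)
  let m : FinAddProb Ω :=
    { toFun := fun A => ψ (A.indicator 1)
      nonneg := hind0
      map_univ := by rw [Set.indicator_univ, hψ1]
      map_union := fun A B hAB => by rw [Set.indicator_union_of_disjoint hAB, ← map_add]; rfl }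
  have hm : m.CountablyAdditive := hσ
  have hneg : ∀ A, O.Negligible A → m.toFun A = 0 := by
    intro A hA
    refine le_antisymm ?_ (hind0 A)
    have := hpos _ (hX.space.neg_mem (hind A)) (by simpa using ge_sub_zero hA)
    rw [map_neg] at this
    change ψ _ ≤ 0
    linarith
  let _ : MeasurableSpace Ω := ⊤
  have : DiscreteMeasurableSpace Ω := ⟨fun _ => trivial⟩
  obtain ⟨μ, hμ, hmμ⟩ := m.exists_measure hm
  have hμ0 : ∀ A, O.Negligible A → μ A = 0 := fun A hA => by
    have := hneg A hA
    rwa [hmμ, measureReal_eq_zero_iff] at this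
  have hint : ∀ f ∈ O.L X, MeasureTheory.Integrable f μ := by
    intro f hf
    have habs : |f| ∈ O.L X := mem_L_of_abs_le hf (by rw [abs_abs]; exact O.refl _)
    have := (integrable_and_integral_le hX hμ0 ψ hmμ hpos habs (O.mono _ _ (abs_nonneg f))).1
    exact this.mono Measurable.of_discrete.aestronglyMeasurable (ae_of_all _ fun ω => by simp)
  have hconst : ∀ a : ℝ, ψ (fun _ => a) = a := fun a => by
    have := ψ.map_smul a 1
    rw [hψ1, smul_eq_mul, mul_one] at this
    exact (congrArg ψ (funext fun ω => (mul_one a).symm)).trans this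
  refine ⟨m, ⟨hneg, fun f hf => (FinAddProb.integrable_iff hmμ).2 (hint f hf), fun f hf => ?_⟩,
    hm, fun f hf hf1 => ?_⟩
  · have hfL := hX.subset_L hf
    rw [FinAddProb.integral_eq_integral hmμ (hint f hfL)]
    refine le_trans ?_ (hle f hf)
    obtain ⟨a, ha⟩ := hX.bddBelow f hf
    have h := (integrable_and_integral_le hX hμ0 ψ hmμ hpos
      (hX.space.sub_mem hfL (hX.const_mem_L a)) (ge_sub_zero ha)).2
    simp only [Pi.sub_apply] at h
    rw [integral_sub (hint f hfL) (integrable_const a), map_sub, hconst] at h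
    simpa using h
  · rw [FinAddProb.integral_eq_integral hmμ (hint f hf)]
    have h := (integrable_and_integral_le hX hμ0 ψ hmμ hpos
      (hX.space.sub_mem (hX.const_mem_L 1) hf)
      (ge_sub_zero (f := fun _ => 1) (O.mono _ _ hf1))).2
    simp only [Pi.sub_apply] at h
    rw [integral_sub (integrable_const 1) (hint f hf), map_sub, hconst] at h
    rw [integral_const, probReal_univ, one_smul] at h
    linarith

end IsMarket

end CommonOrder

end

/-! ### From pricing functionals to measures and back. -/

namespace CommonOrder

variable {Ω : Type*} {O : CommonOrder Ω} {X : Set (Ω → ℝ)} {π ρ : (Ω → ℝ) → ℝ}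

namespace IsMarket

theorem mem_L_of_nonneg_bounded (hX : O.IsMarket X) {g : Ω → ℝ} (h0 : 0 ≤ g)
    (hg : ∃ C : ℝ, ∀ ω, g ω ≤ C) : g ∈ O.L X := by
  obtain ⟨C, hC⟩ := hg
  exact hX.mem_L_of_bounded fun ω => (abs_of_nonneg (h0 ω)).trans_le (hC ω)

theorem pricing_zero (hX : O.IsMarket X) (hρ : O.IsPricing (O.L X) ρ) : ρ 0 = 0 := by
  have h0 : (0 : Ω → ℝ) ∈ O.L X := hX.space.zero_mem
  have := hρ.posHom 0 h0 2 two_pos (by rwa [smul_zero])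
  rw [smul_zero] at this
  linarith

theorem pricing_nonneg (hX : O.IsMarket X) (hρ : O.IsPricing (O.L X) ρ) {g : Ω → ℝ}
    (h0 : 0 ≤ g) (hg : ∃ C : ℝ, ∀ ω, g ω ≤ C) : 0 ≤ ρ g := by
  rw [← hX.pricing_zero hρ]
  exact hρ.mono g (hX.mem_L_of_nonneg_bounded h0 hg) 0 hX.space.zero_mem (O.mono _ _ h0)

theorem exists_linear_le_pricing (hX : O.IsMarket X) (hρ : O.IsPricing (O.L X) ρ)
    (P : (Ω → ℝ) → Prop) (P_smul : ∀ c : ℝ, 0 < c → ∀ f, P f → P (c • f)) (δ : ℝ)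
    (hP : ∀ l : List (Ω → ℝ), (∀ f ∈ l, P f) → δ * (l.map ρ).sum ≤ ρ l.sum) :
    ∃ ψ : (Ω → ℝ) →ₗ[ℝ] ℝ, (∀ f ∈ O.L X, ψ f ≤ ρ f) ∧ ∀ f ∈ O.L X, P f → δ * ρ f ≤ ψ f := by
  obtain ⟨φ, h1, h2⟩ := exists_linear_ge_on (E := hX.space) (fun f => ρ f)
    (fun c hc f => hρ.posHom f f.2 c hc (hX.space.smul_mem c f.2))
    (fun f g => hρ.subadd f f.2 g g.2 (hX.space.add_mem f.2 g.2)) (fun f => P f)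
    (fun c hc f => P_smul c hc f) δ
    (fun l hl => by
      have := hP (l.map hX.space.subtype) fun f hf => by
        obtain ⟨g, hg, rfl⟩ := List.mem_map.1 hf
        exact hl g hg
      rwa [List.map_map, ← map_list_sum] at this)
  obtain ⟨ψ, hψ⟩ := φ.exists_extend
  have h3 : ∀ f : hX.space, ψ f = φ f := fun f => LinearMap.congr_fun hψ f
  exact ⟨ψ, fun f hf => (h3 ⟨f, hf⟩).trans_le (h1 ⟨f, hf⟩),
    fun f hf hPf => (h2 ⟨f, hf⟩ hPf).trans_eq (h3 ⟨f, hf⟩).symm⟩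

theorem linear_nonneg (hX : O.IsMarket X) (hρ : O.IsPricing (O.L X) ρ)
    {ψ : (Ω → ℝ) →ₗ[ℝ] ℝ} (hψ : ∀ f ∈ O.L X, ψ f ≤ ρ f) {g : Ω → ℝ} (hg : g ∈ O.L X)
    (h0 : O.ge g 0) : 0 ≤ ψ g := by
  have hg' := hX.space.neg_mem hg
  have h1 := hψ _ hg'
  have h2 := hρ.mono 0 hX.space.zero_mem (-g) hg' (by simpa using ge_add_right h0 (-g))
  rw [hX.pricing_zero hρ] at h2
  rw [map_neg] at h1
  linarith

/-- The remainder after `k` terms is `ψ` of the indicator of the tail union, at most `K` times the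
tail of the convergent series `∑ ρ (1_{Aₙ})`. -/
theorem hasSum_linear_indicator (hX : O.IsMarket X) (hρ : O.IsPricing (O.L X) ρ)
    {ψ : (Ω → ℝ) →ₗ[ℝ] ℝ} (hψ : ∀ f ∈ O.L X, ψ f ≤ ρ f) (hnac : nac ρ < ⊤)
    (hsum : ∀ f : ℕ → Ω → ℝ, BoundedSumSeq f → Summable fun n => ρ (f n)) {A : ℕ → Set Ω}
    (hA : Pairwise (Function.onFun Disjoint A)) :
    HasSum (fun n => ψ ((A n).indicator 1)) (ψ ((⋃ n, A n).indicator 1)) := by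
  obtain ⟨K, hK⟩ := exists_le_mul_tsum_of_nac_lt_top (fun g => hX.pricing_nonneg hρ) hnac
  have hL : ∀ B : Set Ω, B.indicator (1 : Ω → ℝ) ∈ O.L X := fun B =>
    hX.mem_L_of_nonneg_bounded (indicator_one_bounds B).1 ⟨1, (indicator_one_bounds B).2⟩
  have h0 : ∀ B : Set Ω, 0 ≤ ψ (B.indicator 1) := fun B =>
    hX.linear_nonneg hρ hψ (hL B) (O.mono _ _ (indicator_one_bounds B).1)
  rw [hasSum_iff_tendsto_nat_of_nonneg fun n => h0 (A n)]
  have hshift : ∀ k, Pairwise (Function.onFun Disjoint fun n => A (n + k)) := fun k i j hij =>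
    hA (by simpa using hij)
  have hdecomp : ∀ k, ψ ((⋃ n, A n).indicator 1) - ∑ n ∈ Finset.range k, ψ ((A n).indicator 1) =
      ψ ((⋃ n, A (n + k)).indicator 1) := by
    intro k
    rw [sub_eq_iff_eq_add', ← map_sum, ← map_add]
    congr 1
    ext ω
    rw [Pi.add_apply, Finset.sum_apply, ← (hasSum_indicator_iUnion hA ω).tsum_eq,
      ← (hasSum_indicator_iUnion (hshift k) ω).tsum_eq,
      (hasSum_indicator_iUnion hA ω).summable.sum_add_tsum_nat_add k]
  have hle : ∀ k, ψ ((⋃ n, A (n + k)).indicator 1) ≤ K * ∑' n, ρ ((A (n + k)).indicator 1) := by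
    intro k
    refine (hψ _ (hL _)).trans ?_
    have hb := boundedSumSeq_indicator (hshift k)
    have h := hK _ hb (hsum _ hb)
    rwa [funext fun ω => (hasSum_indicator_iUnion (hshift k) ω).tsum_eq] at h
  have ht : Tendsto (fun k => ψ ((⋃ n, A (n + k)).indicator 1)) atTop (𝓝 0) := by
    refine squeeze_zero (fun k => h0 _) hle ?_
    simpa using (tendsto_sum_nat_add fun n => ρ ((A n).indicator 1)).const_mul K
  have := (tendsto_const_nhds (x := ψ ((⋃ n, A n).indicator 1))).sub ht
  rw [sub_zero] at this
  refine this.congr fun k => ?_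
  rw [← hdecomp]
  ring

end IsMarket

theorem ae_null_of_isPricingMeasure [MeasurableSpace Ω] {μ : MeasureTheory.Measure Ω}
    [MeasureTheory.IsFiniteMeasure μ] {m : FinAddProb Ω} (hμ : ∀ A, m.toFun A = μ.real A)
    (hm : O.IsPricingMeasure X π m) {A : Set Ω} (hA : O.Negligible A) : μ A = 0 := by
  have := hm.negligible A hA
  rwa [hμ, MeasureTheory.measureReal_eq_zero_iff] at this

theorem exists_ext_of_pricingMeasure (hX : O.IsMarket X) {m : FinAddProb Ω}
    (hm : m ∈ O.M₀ X π) (hσ : m.CountablyAdditive) :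
    ∃ ρ ∈ O.Ext₀ X π, CashAdditive (O.L X) ρ ∧ nac ρ < ⊤ ∧ mac ρ < 1 ∧
      (∀ f : ℕ → Ω → ℝ, BoundedSumSeq f → Summable fun n => ρ (f n)) ∧
      ∀ f ∈ O.L X, ρ f = m.integral f := by
  let _ : MeasurableSpace Ω := ⊤
  have : DiscreteMeasurableSpace Ω := ⟨fun _ => trivial⟩
  obtain ⟨μ, _, hmμ⟩ := m.exists_measure hσ
  have hint : ∀ f ∈ O.L X, MeasureTheory.Integrable f μ := fun f hf =>
    (FinAddProb.integrable_iff hmμ).1 (hm.integrable f hf)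
  refine ⟨fun f => ∫ ω, f ω ∂μ,
    ⟨isPricing_integral (fun A hA => ae_null_of_isPricingMeasure hmμ hm hA) hint, fun f hf => ?_⟩,
    fun f hf a _ => ?_, mac_integral_le.1.trans_lt EReal.zero_lt_top,
    mac_integral_le.2.trans_lt zero_lt_one, fun f hf => (hasSum_integral_of_boundedSumSeq hf).summable,
    fun f hf => (FinAddProb.integral_eq_integral hmμ (hint f hf)).symm⟩
  · exact (FinAddProb.integral_eq_integral hmμ (hint f (hX.subset_L hf))).symm.trans_le (hm.le f hf)
  · change ∫ ω, f ω + a ∂μ = ∫ ω, f ω ∂μ + a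
    rw [MeasureTheory.integral_add (hint f hf) (MeasureTheory.integrable_const a)]
    simp

theorem inf_one_mem_L (hX : O.IsMarket X) {f : Ω → ℝ} (hf : O.ge f 0) : f ⊓ 1 ∈ O.L X := by
  have h1 := ge_inf_zero hf zero_le_one
  refine mem_L_of_abs_le (hX.const_mem_L 1) (O.trans _ (f ⊓ 1) _ (O.mono _ _ fun ω => ?_) (ge_abs h1))
  simp

theorem exists_pricingMeasure_of_ext₀ (hX : O.IsMarket X) (hρ : ρ ∈ O.Ext₀ X π)
    (hnac : nac ρ < ⊤)
    (hsum : ∀ f : ℕ → Ω → ℝ, BoundedSumSeq f → Summable fun n => ρ (f n)) :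
    ∃ m ∈ O.M₀ X π, m.CountablyAdditive := by
  obtain ⟨hρ, hle⟩ := hρ
  have hone : (1 : Ω → ℝ) ∈ O.L X := hX.const_mem_L 1
  have hc : ∀ t : ℝ, 0 ≤ t → ρ (t • 1) = t := by
    intro t ht
    rcases ht.eq_or_lt with rfl | ht
    · rw [zero_smul, hX.pricing_zero hρ]
    · rw [hρ.posHom 1 hone t ht (hX.space.smul_mem t hone), hρ.map_one, mul_one]
  have hlist : ∀ l : List (Ω → ℝ), (∀ f ∈ l, ∃ t : ℝ, 0 ≤ t ∧ f = t • 1) →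
      ∃ t : ℝ, 0 ≤ t ∧ l.sum = t • 1 ∧ (l.map ρ).sum = t := by
    intro l
    induction l with
    | nil => exact fun _ => ⟨0, le_rfl, by simp⟩
    | cons a l ih =>
      intro hl
      obtain ⟨t, ht, h1, h2⟩ := ih fun f hf => hl f (List.mem_cons_of_mem a hf)
      obtain ⟨s, hs, rfl⟩ := hl a List.mem_cons_self
      exact ⟨s + t, by positivity, by rw [List.sum_cons, h1, add_smul],
        by rw [List.map_cons, List.sum_cons, h2, hc s hs]⟩
  -- Domination by `ρ` alone gives only `ψ 1 ≤ 1`. On nonnegative constants `ρ` is additive, so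
  -- there the lower bound holds with `δ = 1`.
  obtain ⟨ψ, h1, h2⟩ := hX.exists_linear_le_pricing hρ (fun f => ∃ t : ℝ, 0 ≤ t ∧ f = t • 1)
    (by
      rintro c hc _ ⟨t, ht, rfl⟩
      exact ⟨c * t, by positivity, smul_smul _ _ _⟩) 1
    (fun l hl => by
      obtain ⟨t, ht, h1, h2⟩ := hlist l hl
      rw [h1, h2, hc t ht, one_mul])
  have hψ1 : ψ 1 = 1 := by
    have h3 := h1 1 hone
    have h4 := h2 1 hone ⟨1, zero_le_one, (one_smul ℝ _).symm⟩
    rw [hρ.map_one] at h3 h4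
    linarith
  obtain ⟨m, hm, hσ, -⟩ := hX.exists_pricingMeasure ψ hψ1
    (fun g hg h0 => hX.linear_nonneg hρ h1 hg h0)
    (fun f hf => (h1 f (hX.subset_L hf)).trans (hle f hf))
    (fun A hA => hX.hasSum_linear_indicator hρ h1 hnac hsum hA)
  exact ⟨m, hm, hσ⟩

theorem exists_strictly_positive_of_ext (hX : O.IsMarket X) (hρ : ρ ∈ O.Ext X π)
    (hcash : CashAdditive (O.L X) ρ) (hnac : nac ρ < ⊤) (hmac : mac ρ < 1) :
    ∃ m ∈ O.M X π, m.CountablyAdditive := by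
  obtain ⟨hprice, hle⟩ := hρ
  have hρ := hprice.toIsPricing
  obtain ⟨δ, hδ, hδρ⟩ := exists_mul_sum_le_of_mac_lt_one (fun g => hX.pricing_nonneg hρ) hmac
  have hsum : ∀ f : ℕ → Ω → ℝ, BoundedSumSeq f → Summable fun n => ρ (f n) := fun f hf =>
    summable_of_sum_range_le (c := δ⁻¹ * ρ fun ω => ∑' n, f n ω)
      (fun n => hX.pricing_nonneg hρ (hf.nonneg n) (hf.bounded n))
      fun k => by
        rw [inv_mul_eq_div, le_div_iff₀' hδ]
        exact hδρ f hf k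
  obtain ⟨ψ, h1, h2⟩ := hX.exists_linear_le_pricing hρ
    (fun f => 0 ≤ f ∧ ∃ C : ℝ, ∀ ω, f ω ≤ C)
    (by
      rintro c hc f ⟨h0, C, hC⟩
      exact ⟨smul_nonneg hc.le h0, c * C, fun ω => mul_le_mul_of_nonneg_left (hC ω) hc.le⟩) δ
    (fun l hl => by
      obtain ⟨hb, hs⟩ := boundedSumSeq_getD hl
      have := hδρ _ hb l.length
      rwa [hs, List.sum_range_getD ρ] at this)
  have hone : (1 : Ω → ℝ) ∈ O.L X := hX.const_mem_L 1
  -- The lower bound gives only `ψ 1 ≥ δ`; cash additivity gives `ψ (-1) ≤ ρ (-1) = -1`.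
  have hψ1 : ψ 1 = 1 := by
    have h3 := h1 1 hone
    have h4 := h1 (-1) (hX.space.neg_mem hone)
    have h5 := hcash 0 hX.space.zero_mem (-1) (by simpa using hX.const_mem_L (-1))
    have h6 : (fun ω => (0 : Ω → ℝ) ω + (-1 : ℝ)) = -1 := by ext ω; simp
    rw [h6, hX.pricing_zero hρ] at h5
    rw [hρ.map_one] at h3
    rw [map_neg] at h4
    linarith
  obtain ⟨m, hm, hσ, hmψ⟩ := hX.exists_pricingMeasure ψ hψ1
    (fun g hg h0 => hX.linear_nonneg hρ h1 hg h0)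
    (fun f hf => (h1 f (hX.subset_L hf)).trans (hle f hf))
    (fun A hA => hX.hasSum_linear_indicator hρ h1 hnac hsum hA)
  refine ⟨m, ⟨hm, fun f hf => ?_⟩, hσ⟩
  have hgt := O.trunc f hf.1 hf.2
  have hfL := inf_one_mem_L hX hf.1
  refine lt_of_lt_of_le ?_ (hmψ _ hfL inf_le_right)
  -- `f ⊓ 1` need not be pointwise nonnegative, so the lower bound is applied to its positive part,
  -- which `f ⊓ 1` dominates for `≥_*`.
  have hP : 0 ≤ (f ⊓ 1) ⊔ 0 ∧ ∃ C : ℝ, ∀ ω, ((f ⊓ 1) ⊔ 0) ω ≤ C := by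
    refine ⟨le_sup_right, 1, fun ω => ?_⟩
    simp
  have hPL := hX.mem_L_of_nonneg_bounded hP.1 hP.2
  have hge : O.ge (f ⊓ 1) ((f ⊓ 1) ⊔ 0) :=
    O.trans _ _ _ (ge_abs hgt.1) (O.mono _ _ (sup_le (le_abs_self _) (abs_nonneg _)))
  have h3 := hX.linear_nonneg hρ h1 (hX.space.sub_mem hfL hPL) (ge_sub_zero hge)
  rw [map_sub] at h3
  have h4 := h2 _ hPL hP
  have h5 := hρ.mono _ hPL _ hfL (O.mono _ _ le_sup_left)
  have h6 := hprice.noArbitrage _ hfL hgt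
  have h7 : 0 < δ * ρ ((f ⊓ 1) ⊔ 0) := mul_pos hδ (h6.trans_le h5)
  linarith

end CommonOrder

theorem mainTheorem6 {Ω : Type*} (O : CommonOrder Ω) (X : Set (Ω → ℝ)) (hX : O.IsMarket X)
    (π : (Ω → ℝ) → ℝ) (hπ : O.IsPricing X π) :
    ((∃ m ∈ O.M₀ X π, m.CountablyAdditive) ↔
      ∃ ρ ∈ O.Ext₀ X π, nac ρ < ⊤ ∧
        ∀ f : ℕ → Ω → ℝ, BoundedSumSeq f → Summable fun n => ρ (f n)) ∧
    ((∃ m ∈ O.M X π, m.CountablyAdditive) ↔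
      ∃ ρ ∈ O.Ext X π, CashAdditive (O.L X) ρ ∧ nac ρ < ⊤ ∧ mac ρ < 1) := by
  refine ⟨⟨?_, ?_⟩, ?_, ?_⟩
  · rintro ⟨m, hm, hσ⟩
    obtain ⟨ρ, hρ, -, hnac, -, hsum, -⟩ := CommonOrder.exists_ext_of_pricingMeasure hX hm hσ
    exact ⟨ρ, hρ, hnac, hsum⟩
  · rintro ⟨ρ, hρ, hnac, hsum⟩
    exact CommonOrder.exists_pricingMeasure_of_ext₀ hX hρ hnac hsum
  · rintro ⟨m, ⟨hm, hpos⟩, hσ⟩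
    obtain ⟨ρ, hρ, hcash, hnac, hmac, -, hint⟩ := CommonOrder.exists_ext_of_pricingMeasure hX hm hσ
    refine ⟨ρ, ⟨⟨hρ.1, fun f hf hgt => ?_⟩, hρ.2⟩, hcash, hnac, hmac⟩
    have hL := CommonOrder.inf_one_mem_L hX hgt.1
    -- Strict positivity of `m` concerns `f ⊓ 1` only; monotonicity carries it to `f`.
    refine lt_of_lt_of_le ?_ (hρ.1.mono f hf _ hL (O.mono _ _ inf_le_left))
    rw [hint _ hL]
    exact hpos f hgt
  · rintro ⟨ρ, hρ, hcash, hnac, hmac⟩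
    exact CommonOrder.exists_strictly_positive_of_ext hX hρ hcash hnac hmac
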